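/- Let $k\ge 2$ and $r\ge 2$ be integers and consider a sequence of stochastic block models with $k$ communities and a total number of nodes $n=\sum_{i=1}^k n_n^{(i)}\to\infty$ (all limits are along this sequence). Community $i$ has $n_n^{(i)}\ge 1$ nodes; $q_n^{(ij)}=q_n^{(ji)}\in[0,1)$ is the probability of an edge between a node of community $i$ and a node of community $j$, and $p_n^{(i)}:=q_n^{(ii)}$. Assume that, for all $i,j$, $$\frac{n_n^{(i)}}{n_n^{(j)}}\to\nu_{ij}\in(0,\infty),\qquad \frac1{n_n^{(i)}}=o\big(p_n^{(i)}\big),\qquad p_n^{(i)}=o\big((n_n^{(i)})^{-1/r}\big),\qquad q_n^{(ij)}\le\min\{p_n^{(i)},p_n^{(j)}\},$$ $$\frac{q_n^{(ij)}}{p_n^{(i)}}\to\gamma_{ij}\in[0,1],\qquad \frac{p_n^{(i)}}{p_n^{(j)}}\to\mu_{ij}\in(0,\infty).$$ Put $\chi_{ij}:=\gamma_{ij}\,(\nu_{ij}\,\mu_{ij}^{\,r})^{1/(r-1)}$; this is the limit of $q_n^{(ij)}g_n^{(j)}/(p_n^{(i)}g_n^{(i)})$, where $g_n^{(i)}:=(1-\tfrac1r)\big(\tfrac{(r-1)!}{n_n^{(i)}(p_n^{(i)})^r}\big)^{1/(r-1)}$.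 Assume that the matrix $\chi=(\chi_{ij})_{1\le i,j\le k}$ is irreducible and invertible. For $\alpha\in[0,\infty)^k$ and $x\in[0,\infty)^k$ let $$\rho_i(x,\alpha):=\alpha_i-x_i+r^{-1}(1-r^{-1})^{r-1}\Big(\sum_{j=1}^k\chi_{ij}x_j\Big)^r,\qquad i=1,\dots,k,$$ $$\mathcal D:=\Big\{x\in\big[0,\tfrac r{r-1}\big]^k:\ x_i+\sum_{j\ne i}\chi_{ij}x_j\le\tfrac r{r-1}\ \text{ for all } i\Big\},\qquad \mathcal D_{\rho,\alpha}:=\{x\in\mathcal D:\ \rho_1(x,\alpha)=\dots=\rho_k(x,\alpha)\},$$ and $m(\alpha):=\min_{x\in\mathcal D_{\rho,\alpha}}\rho_1(x,\alpha)$, with $m(\alpha):=+\infty$ if $\mathcal D_{\rho,\alpha}=\emptyset$. Define $$\mathcal R_{Sub}:=\{\alpha\in[0,\infty)^k: m(\alpha)<0\},\quad \mathcal R_{Crit}:=\{\alpha\in[0,\infty)^k: m(\alpha)=0\},\quad \mathcal R_{Sup}:=\{\alpha\in[0,\infty)^k: m(\alpha)>0\}.$$ For $\theta=(1,\theta_2,\dots,\theta_k)\in(0,\infty)^k$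 such that all entries of the row vector $\theta\chi^{-1}\mathrm{diag}(\theta^{-1})$ are non-negative, where $\mathrm{diag}(\theta^{-1})$ is the diagonal matrix with diagonal entries $1,\theta_2^{-1},\dots,\theta_k^{-1}$, let $x_\theta$ be the row vector with entries $$(x_\theta)_i:=\frac r{r-1}\Big(\theta\chi^{-1}\mathrm{diag}(\theta^{-1})\Big)_i^{1/(r-1)},\qquad i=1,\dots,k.$$ Then $$\mathcal R_{Crit}=\Big\{\alpha\in[0,1]^k:\ \text{there is such a } \theta \text{ with } \alpha_i=\big(x_\theta(\chi^{-1})^t\big)_i-r^{-1}(1-r^{-1})^{r-1}(x_\theta)_i^{\,r}\ \text{ for all } i\Big\},$$ $$\mathcal R_{Sub}=\big\{\alpha\in[0,1]^k:\ \{\theta\alpha:\theta\in[0,1]\}\cap\mathcal R_{Crit}=\emptyset\big\},$$ $$\mathcal R_{Sup}=\big\{\alpha\in[0,\infty)^k:\ \{\theta\alpha:\theta\in[0,1)\}\cap\mathcal R_{Crit}\ne\emptyset\big\}.$$ -/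

import Mathlib

open Filter Topology Asymptotics Matrix

/-- A sequence of stochastic block models with `k` communities and a growing number of nodes.
In the `t`-th model the community `i` has `size t i` nodes, and a node of community `i` and a node
of community `j` are joined with probability `q t i j`; the total number of nodes
`∑ i, size t i` tends to infinity. -/
structure SBMSequence (k : ℕ) where
  size : ℕ → Fin k → ℕ
  q : ℕ → Fin k → Fin k → ℝ
  size_pos : ∀ t i, 1 ≤ size t i
  q_nonneg : ∀ t i j, 0 ≤ q t i j
  q_lt_one : ∀ t i j, q t i j < 1
  q_symm : ∀ t i j, q t i j = q t j i
  total_tendsto : Tendsto (fun t => ∑ i, size t i) atTop atTop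

namespace SBMSequence

variable {k : ℕ}

/-- The edge probability inside community `i`. -/
def p (S : SBMSequence k) (t : ℕ) (i : Fin k) : ℝ := S.q t i i

/-- The critical number of seeds of community `i`. -/
noncomputable def g (S : SBMSequence k) (r t : ℕ) (i : Fin k) : ℝ :=
  (1 - 1 / (r : ℝ)) *
    (((r - 1).factorial : ℝ) / ((S.size t i : ℝ) * S.p t i ^ r)) ^ (1 / ((r : ℝ) - 1))

/-- The asymptotic assumptions on a sequence of stochastic block models with activation
threshold `r`, where `ν`, `γ`, `μ` are the limits of the ratios of the community sizes, of
`q i j / p i`, and of `p i / p j`. -/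
structure Assumptions (S : SBMSequence k) (r : ℕ) (ν γ μ : Fin k → Fin k → ℝ) : Prop where
  tendsto_size : ∀ i j, Tendsto (fun t => (S.size t i : ℝ) / (S.size t j : ℝ)) atTop (𝓝 (ν i j))
  ν_pos : ∀ i j, 0 < ν i j
  p_lower : ∀ i, (fun t => 1 / (S.size t i : ℝ)) =o[atTop] (fun t => S.p t i)
  p_upper : ∀ i, (fun t => S.p t i) =o[atTop] (fun t => 1 / (S.size t i : ℝ) ^ (1 / (r : ℝ)))
  q_le : ∀ t i j, S.q t i j ≤ min (S.p t i) (S.p t j)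
  tendsto_q : ∀ i j, Tendsto (fun t => S.q t i j / S.p t i) atTop (𝓝 (γ i j))
  tendsto_p : ∀ i j, Tendsto (fun t => S.p t i / S.p t j) atTop (𝓝 (μ i j))
  μ_pos : ∀ i j, 0 < μ i j

end SBMSequence

namespace BlockPercolation

variable {k : ℕ}

/-- The matrix `χ`, with entries `γ i j * (ν i j * μ i j ^ r) ^ (1 / (r - 1))`. -/
noncomputable def chi (r : ℕ) (ν γ μ : Fin k → Fin k → ℝ) : Matrix (Fin k) (Fin k) ℝ :=
  fun i j => γ i j * (ν i j * μ i j ^ r) ^ (1 / ((r : ℝ) - 1))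

/-- The entries of `χ` are the limits of `q i j * g j / (p i * g i)`. -/
theorem tendsto_chi {S : SBMSequence k} {r : ℕ} (hr : 2 ≤ r) {ν γ μ : Fin k → Fin k → ℝ}
    (h : S.Assumptions r ν γ μ) (i j : Fin k) :
    Tendsto (fun t => S.q t i j * S.g r t j / (S.p t i * S.g r t i)) atTop
      (𝓝 (chi r ν γ μ i j)) := by
  have hr' : (2 : ℝ) ≤ r := by exact_mod_cast hr
  have hc : (0 : ℝ) < 1 - 1 / (r : ℝ) := by
    rw [sub_pos, div_lt_one (by linarith)]; linarith
  have he : (0 : ℝ) < 1 / ((r : ℝ) - 1) := by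
    apply one_div_pos.2; linarith
  have hp : ∀ i, ∀ᶠ t in atTop, 0 < S.p t i := by
    intro i
    filter_upwards [(h.p_lower i).bound one_pos] with t ht
    have hs : (0 : ℝ) < S.size t i := by exact_mod_cast S.size_pos t i
    have h0 : 0 < ‖1 / (S.size t i : ℝ)‖ := norm_pos_iff.2 (one_div_pos.2 hs).ne'
    have h1 : 0 < ‖S.p t i‖ := by linarith
    exact lt_of_le_of_ne (S.q_nonneg t i i) (Ne.symm (norm_pos_iff.1 h1))
  have hlim : Tendsto (fun t => S.q t i j / S.p t i *
      ((S.size t i : ℝ) / (S.size t j : ℝ) * (S.p t i / S.p t j) ^ r) ^ (1 / ((r : ℝ) - 1)))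
      atTop (𝓝 (chi r ν γ μ i j)) :=
    (h.tendsto_q i j).mul (((h.tendsto_size i j).mul ((h.tendsto_p i j).pow r)).rpow_const
      (Or.inr he.le))
  refine hlim.congr' ?_
  filter_upwards [hp i, hp j] with t hi hj
  have hsi : (0 : ℝ) < S.size t i := by exact_mod_cast S.size_pos t i
  have hsj : (0 : ℝ) < S.size t j := by exact_mod_cast S.size_pos t j
  have hf : (0 : ℝ) < ((r - 1).factorial : ℝ) := by exact_mod_cast Nat.factorial_pos _
  have key : ((S.size t i : ℝ) / (S.size t j : ℝ) * (S.p t i / S.p t j) ^ r) =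
      (((r - 1).factorial : ℝ) / ((S.size t j : ℝ) * S.p t j ^ r)) /
        (((r - 1).factorial : ℝ) / ((S.size t i : ℝ) * S.p t i ^ r)) := by
    rw [div_pow]
    field_simp
  have hgi : 0 < (((r - 1).factorial : ℝ) / ((S.size t i : ℝ) * S.p t i ^ r)) ^
      (1 / ((r : ℝ) - 1)) := by positivity
  rw [key, Real.div_rpow (by positivity) (by positivity), SBMSequence.g, SBMSequence.g]
  have hr1 : (r : ℝ) - 1 ≠ 0 := by linarith
  field_simp

/-- The functions `ρ i`, for the seed vector `α`. -/
noncomputable def rho (r : ℕ) (χ : Matrix (Fin k) (Fin k) ℝ) (α : Fin k → ℝ) (i : Fin k)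
    (x : Fin k → ℝ) : ℝ :=
  α i - x i + (r : ℝ)⁻¹ * (1 - (r : ℝ)⁻¹) ^ (r - 1) * (∑ j, x j * χ i j) ^ r

/-- The domain `𝒟`. -/
def domain (r : ℕ) (χ : Matrix (Fin k) (Fin k) ℝ) : Set (Fin k → ℝ) :=
  {x | (∀ i, x i ∈ Set.Icc (0 : ℝ) ((r : ℝ) / ((r : ℝ) - 1))) ∧
    ∀ i, x i + ∑ j ∈ Finset.univ.erase i, χ i j * x j ≤ (r : ℝ) / ((r : ℝ) - 1)}

/-- The set `𝒟_ρ` of points of `𝒟` at which all the `ρ i` agree. -/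
def domainRho (r : ℕ) (χ : Matrix (Fin k) (Fin k) ℝ) (α : Fin k → ℝ) : Set (Fin k → ℝ) :=
  {x | x ∈ domain r χ ∧ ∀ i j, rho r χ α i x = rho r χ α j x}

/-- The values of `ρ` for the first community on `𝒟_ρ`; the regions are defined through the
minimum of this set. -/
def rhoValues [NeZero k] (r : ℕ) (χ : Matrix (Fin k) (Fin k) ℝ) (α : Fin k → ℝ) : Set ℝ :=
  rho r χ α 0 '' domainRho r χ α

/-- The sub-critical region. -/
def regionSub [NeZero k] (r : ℕ) (χ : Matrix (Fin k) (Fin k) ℝ) : Set (Fin k → ℝ) :=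
  {α | (∀ i, 0 ≤ α i) ∧ ∃ m < 0, IsLeast (rhoValues r χ α) m}

/-- The critical region. -/
def regionCrit [NeZero k] (r : ℕ) (χ : Matrix (Fin k) (Fin k) ℝ) : Set (Fin k → ℝ) :=
  {α | (∀ i, 0 ≤ α i) ∧ IsLeast (rhoValues r χ α) 0}

/-- The super-critical region; the minimum over the empty set is `+∞`, so that `α` belongs to the
region when `𝒟_ρ` is empty. -/
def regionSup [NeZero k] (r : ℕ) (χ : Matrix (Fin k) (Fin k) ℝ) : Set (Fin k → ℝ) :=
  {α | (∀ i, 0 ≤ α i) ∧ (rhoValues r χ α = ∅ ∨ ∃ m > 0, IsLeast (rhoValues r χ α) m)}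

/-- The row vector `θ χ⁻¹ diag(θ⁻¹)`. -/
noncomputable def baseVec (χ : Matrix (Fin k) (Fin k) ℝ) (θ : Fin k → ℝ) : Fin k → ℝ :=
  θ ᵥ* (χ⁻¹ * diagonal fun i => (θ i)⁻¹)

/-- The row vector `x_θ`. -/
noncomputable def xVec (r : ℕ) (χ : Matrix (Fin k) (Fin k) ℝ) (θ : Fin k → ℝ) : Fin k → ℝ :=
  fun i => (r : ℝ) / ((r : ℝ) - 1) * baseVec χ θ i ^ (1 / ((r : ℝ) - 1))

end BlockPercolation

namespace BlockPercolation

/-! Each `rho i` is `α i - x i + gain (χ x) i`, with `gain` convex and increasing on `[0, ∞)` and `χ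
i i = 1`. Two facts drive everything. Monotonicity: below any point where all `rho` are nonpositive
lies a common zero (`exists_le_rho_eq_zero`). Hence `α` is sub-critical iff all `rho` are negative
at some `x ≥ 0`, without the domain or the equality constraint (`mem_regionSub_iff`), and critical
iff it is not sub-critical but the `rho` have a common zero in the domain. Convexity: at a critical
`α`, Hahn–Banach gives weights `θ ≥ 0` for which the weighted sum of the `rho` is minimal at the
common zero `x` (`exists_weights`). Its vanishing gradient says `θ diag(slope (χ x)) χ = θ`;
irreducibility makes `θ` positive, and solving for `χ x` gives `xVec`. Conversely, this gradient
condition makes `x` a minimiser of the weighted sum, with value zero, so the `rho` cannot all be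
negative anywhere (`sum_mul_rho_le`). Along a ray from the origin the sub-critical parameters form a
relatively open set, which is also closed if no critical point is met. The same weights show that a
ray meets the critical region at most once. -/

/-- The coefficient of the nonlinear term of `rho`. -/
noncomputable def coef (r : ℕ) : ℝ := (r : ℝ)⁻¹ * (1 - (r : ℝ)⁻¹) ^ (r - 1)

/-- The nonlinear term of `rho`. -/
noncomputable def gain (r : ℕ) (y : ℝ) : ℝ := coef r * y ^ r

/-- The derivative of `gain`. -/
noncomputable def slope (r : ℕ) (y : ℝ) : ℝ := ((1 - (r : ℝ)⁻¹) * y) ^ (r - 1)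

/-! ### Convexity and inversion for the scalar nonlinearity. -/

section Scalar

variable {r : ℕ}

theorem inv_lt_one_of_two_le (hr : 2 ≤ r) : (r : ℝ)⁻¹ < 1 := by
  have : (2 : ℝ) ≤ r := by exact_mod_cast hr
  exact inv_lt_one_of_one_lt₀ (by linarith)

theorem one_sub_inv_pos (hr : 2 ≤ r) : 0 < 1 - (r : ℝ)⁻¹ := by
  linarith [inv_lt_one_of_two_le hr]

theorem coef_pos (hr : 2 ≤ r) : 0 < coef r := by
  have h := one_sub_inv_pos hr
  have : (0 : ℝ) < r := by exact_mod_cast (by omega : 0 < r)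
  unfold coef
  positivity

theorem coef_lt_one (hr : 2 ≤ r) : coef r < 1 := by
  have h := one_sub_inv_pos hr
  have h0 : (0 : ℝ) < (r : ℝ)⁻¹ := by
    have : (0 : ℝ) < r := by exact_mod_cast (by omega : 0 < r)
    positivity
  calc coef r ≤ (r : ℝ)⁻¹ * 1 := by
        unfold coef
        gcongr
        exact pow_le_one₀ h.le (by linarith)
    _ < 1 := by linarith [inv_lt_one_of_two_le hr]

theorem slope_eq (hr : 2 ≤ r) (y : ℝ) : slope r y = coef r * (r * y ^ (r - 1)) := by
  have : (r : ℝ) ≠ 0 := by exact_mod_cast (by omega : r ≠ 0)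
  unfold slope coef
  rw [mul_pow]
  field_simp

theorem slope_nonneg (hr : 2 ≤ r) {y : ℝ} (hy : 0 ≤ y) : 0 ≤ slope r y :=
  pow_nonneg (mul_nonneg (one_sub_inv_pos hr).le hy) _

theorem slope_pos (hr : 2 ≤ r) {y : ℝ} (hy : 0 < y) : 0 < slope r y :=
  pow_pos (mul_pos (one_sub_inv_pos hr) hy) _

theorem gain_nonneg (hr : 2 ≤ r) {y : ℝ} (hy : 0 ≤ y) : 0 ≤ gain r y :=
  mul_nonneg (coef_pos hr).le (pow_nonneg hy _)

theorem gain_mono (hr : 2 ≤ r) {y z : ℝ} (hy : 0 ≤ y) (hyz : y ≤ z) : gain r y ≤ gain r z :=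
  mul_le_mul_of_nonneg_left (pow_le_pow_left₀ hy hyz _) (coef_pos hr).le

theorem pow_tangent (n : ℕ) {y z : ℝ} (hy : 0 ≤ y) (hz : 0 ≤ z) :
    (n + 1 : ℝ) * y ^ n * (z - y) ≤ z ^ (n + 1) - y ^ (n + 1) := by
  induction n with
  | zero => simp
  | succ n ih =>
    have h1 := mul_le_mul_of_nonneg_left ih hz
    have h2 : 0 ≤ (n + 1 : ℝ) * y ^ n * (z - y) ^ 2 := by positivity
    push_cast
    have e : z ^ (n + 1 + 1) - y ^ (n + 1 + 1) - (n + 1 + 1 : ℝ) * y ^ (n + 1) * (z - y) =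
        (z * (z ^ (n + 1) - y ^ (n + 1)) - z * ((n + 1 : ℝ) * y ^ n * (z - y))) +
          (n + 1 : ℝ) * y ^ n * (z - y) ^ 2 := by ring
    linarith

theorem gain_tangent (hr : 2 ≤ r) {y z : ℝ} (hy : 0 ≤ y) (hz : 0 ≤ z) :
    slope r y * (z - y) ≤ gain r z - gain r y := by
  obtain ⟨n, rfl⟩ : ∃ n, r = n + 1 := ⟨r - 1, by omega⟩
  have h := mul_le_mul_of_nonneg_left (pow_tangent n hy hz) (coef_pos hr).le
  rw [slope_eq hr]
  unfold gain
  simp only [Nat.add_sub_cancel]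
  push_cast
  linarith

theorem one_sub_inv_mul (hr : 2 ≤ r) : (1 - (r : ℝ)⁻¹) * ((r : ℝ) / (r - 1)) = 1 := by
  have h2 : (2 : ℝ) ≤ r := by exact_mod_cast hr
  have h1 : (r : ℝ) - 1 ≠ 0 := by linarith
  have h0 : (r : ℝ) ≠ 0 := by linarith
  field_simp

theorem div_sub_one_pos (hr : 2 ≤ r) : 0 < (r : ℝ) / (r - 1) := by
  have h2 : (2 : ℝ) ≤ r := by exact_mod_cast hr
  exact div_pos (by linarith) (by linarith)

/-- The tangent to `gain` at `r / (r - 1)` has slope one, and there `y - gain r y` equals 1. This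
bound confines sub-critical and critical seed vectors to the unit cube. -/
theorem sub_gain_le_one (hr : 2 ≤ r) {y : ℝ} (hy : 0 ≤ y) : y - gain r y ≤ 1 := by
  have h2 : (2 : ℝ) ≤ r := by exact_mod_cast hr
  have h1 : (r : ℝ) - 1 ≠ 0 := by linarith
  have h0 : (r : ℝ) ≠ 0 := by linarith
  have hb := one_sub_inv_mul hr
  have ht := gain_tangent hr (div_sub_one_pos hr).le hy
  have hs : slope r ((r : ℝ) / (r - 1)) = 1 := by rw [slope, hb, one_pow]
  have hg : gain r ((r : ℝ) / (r - 1)) = (r : ℝ) / (r - 1) - 1 := by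
    obtain ⟨n, rfl⟩ : ∃ n, r = n + 1 := ⟨r - 1, by omega⟩
    unfold gain coef
    rw [Nat.add_sub_cancel, pow_succ, mul_assoc, ← mul_assoc (_ ^ n), ← mul_pow, hb, one_pow]
    field_simp
    ring
  rw [hs, hg] at ht
  linarith

theorem le_of_slope_le_one (hr : 2 ≤ r) {y : ℝ} (h : slope r y ≤ 1) (hy : 0 ≤ y) :
    y ≤ (r : ℝ) / (r - 1) := by
  have hc := one_sub_inv_pos hr
  have h' : (1 - (r : ℝ)⁻¹) * y ≤ 1 :=
    (pow_le_one_iff_of_nonneg (mul_nonneg hc.le hy) (by omega)).1 h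
  exact le_of_mul_le_mul_left (h'.trans_eq (one_sub_inv_mul hr).symm) hc

/-- With `slope_of_rpow`, this makes the power formula in `xVec` the inverse of `slope` on
nonnegative reals. -/
theorem slope_rpow (hr : 2 ≤ r) {y : ℝ} (hy : 0 ≤ y) :
    (r : ℝ) / (r - 1) * slope r y ^ (1 / ((r : ℝ) - 1)) = y := by
  have h2 : (2 : ℝ) ≤ r := by exact_mod_cast hr
  have h1 : (r : ℝ) - 1 ≠ 0 := by linarith
  have hc := one_sub_inv_pos hr
  rw [slope, ← Real.rpow_natCast, ← Real.rpow_mul (mul_nonneg hc.le hy),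
    Nat.cast_sub (by omega), Nat.cast_one, mul_one_div_cancel h1, Real.rpow_one, ← mul_assoc,
    mul_comm _ (1 - _), one_sub_inv_mul hr, one_mul]

theorem slope_of_rpow (hr : 2 ≤ r) {v : ℝ} (hv : 0 ≤ v) :
    slope r ((r : ℝ) / (r - 1) * v ^ (1 / ((r : ℝ) - 1))) = v := by
  have h2 : (2 : ℝ) ≤ r := by exact_mod_cast hr
  have h1 : (r : ℝ) - 1 ≠ 0 := by linarith
  rw [slope, ← mul_assoc, one_sub_inv_mul hr, one_mul, ← Real.rpow_natCast, ← Real.rpow_mul hv,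
    Nat.cast_sub (by omega), Nat.cast_one, one_div_mul_cancel h1, Real.rpow_one]

end Scalar

/-! ### The matrix `χ`, the domain, and monotone descent to a common zero. -/

section Matrix

variable {k : ℕ}

/-- If a property spreads along the positive entries of an irreducible matrix, then it holds
everywhere as soon as it holds somewhere. -/
theorem forall_of_isIrreducible {n : Type*} {A : Matrix n n ℝ} (hA : A.IsIrreducible)
    {P : n → Prop} (hP : ∀ i j, P i → 0 < A i j → P j) {i : n} (hi : P i) (j : n) : P j := by
  let : Quiver n := toQuiver A
  obtain ⟨p, -⟩ := hA.connected i j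
  induction p with
  | nil => exact hi
  | cons _ e ih => exact hP _ _ ih e.down

/-- For `i = j` all three ratios are eventually 1. This is all that the proof takes from the
asymptotic assumptions. -/
theorem chi_diag {S : SBMSequence k} {r : ℕ} {ν γ μ : Fin k → Fin k → ℝ}
    (h : S.Assumptions r ν γ μ) (i : Fin k) : chi r ν γ μ i i = 1 := by
  have hp : ∀ᶠ t in atTop, S.p t i ≠ 0 := by
    filter_upwards [(h.p_lower i).bound one_pos] with t ht h0
    have hs : (0 : ℝ) < S.size t i := by exact_mod_cast S.size_pos t i
    have := norm_pos_iff.2 (one_div_pos.2 hs).ne'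
    rw [h0, norm_zero, mul_zero] at ht
    linarith
  have hone : ∀ {u : ℕ → ℝ} {l : ℝ}, Tendsto u atTop (𝓝 l) → (∀ᶠ t in atTop, u t = 1) → l = 1 :=
    fun hu h1 => tendsto_nhds_unique hu (tendsto_const_nhds.congr' (h1.mono fun _ e => e.symm))
  have hγ : γ i i = 1 := hone (h.tendsto_q i i) (hp.mono fun t ht => div_self ht)
  have hμ : μ i i = 1 := hone (h.tendsto_p i i) (hp.mono fun t ht => div_self ht)
  have hν : ν i i = 1 := hone (h.tendsto_size i i) (Eventually.of_forall fun t =>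
    div_self (by exact_mod_cast Nat.one_le_iff_ne_zero.1 (S.size_pos t i)))
  simp [chi, hγ, hμ, hν]

/-- The `i`-th entry of `χ x`. -/
def influence (χ : Matrix (Fin k) (Fin k) ℝ) (x : Fin k → ℝ) (i : Fin k) : ℝ := ∑ j, x j * χ i j

theorem rho_eq (r : ℕ) (χ : Matrix (Fin k) (Fin k) ℝ) (α : Fin k → ℝ) (i : Fin k)
    (x : Fin k → ℝ) : rho r χ α i x = α i - x i + gain r (influence χ x i) := rfl

theorem continuous_rho (r : ℕ) (χ : Matrix (Fin k) (Fin k) ℝ) (i : Fin k) :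
    Continuous fun z : (Fin k → ℝ) × (Fin k → ℝ) => rho r χ z.1 i z.2 := by
  unfold rho; fun_prop

theorem influence_mulVec (χ : Matrix (Fin k) (Fin k) ℝ) (x : Fin k → ℝ) :
    influence χ x = χ *ᵥ x := by
  ext i; simp [influence, mulVec, dotProduct, mul_comm]

theorem influence_add_smul (χ : Matrix (Fin k) (Fin k) ℝ) (x z : Fin k → ℝ) (a b : ℝ) (i : Fin k) :
    influence χ (a • x + b • z) i = a * influence χ x i + b * influence χ z i := by
  simp [influence_mulVec, mulVec_add, mulVec_smul]

theorem influence_sub (χ : Matrix (Fin k) (Fin k) ℝ) (x z : Fin k → ℝ) (i : Fin k) :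
    influence χ (x - z) i = influence χ x i - influence χ z i := by
  simp [influence_mulVec, mulVec_sub]

variable {r : ℕ} {χ : Matrix (Fin k) (Fin k) ℝ}

theorem influence_mono (h0 : ∀ i j, 0 ≤ χ i j) {x z : Fin k → ℝ} (h : x ≤ z) (i : Fin k) :
    influence χ x i ≤ influence χ z i :=
  Finset.sum_le_sum fun j _ => mul_le_mul_of_nonneg_right (h j) (h0 i j)

theorem influence_nonneg (h0 : ∀ i j, 0 ≤ χ i j) {x : Fin k → ℝ} (h : 0 ≤ x) (i : Fin k) :
    0 ≤ influence χ x i :=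
  Finset.sum_nonneg fun j _ => mul_nonneg (h j) (h0 i j)

theorem le_influence (h0 : ∀ i j, 0 ≤ χ i j) (h1 : ∀ i, χ i i = 1) {x : Fin k → ℝ} (h : 0 ≤ x)
    (i : Fin k) : x i ≤ influence χ x i := by
  have := Finset.single_le_sum (f := fun j => x j * χ i j)
    (fun j _ => mul_nonneg (h j) (h0 i j)) (Finset.mem_univ i)
  simpa only [h1, mul_one, influence] using this

/-- The unit diagonal turns the second family of constraints into bounds on `χ x`, and these imply
the upper bounds on the coordinates. -/
theorem mem_domain_iff (h0 : ∀ i j, 0 ≤ χ i j) (h1 : ∀ i, χ i i = 1) {x : Fin k → ℝ} :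
    x ∈ domain r χ ↔ 0 ≤ x ∧ ∀ i, influence χ x i ≤ (r : ℝ) / ((r : ℝ) - 1) := by
  have he : ∀ i, x i + ∑ j ∈ Finset.univ.erase i, χ i j * x j = influence χ x i := by
    intro i
    rw [influence, ← Finset.add_sum_erase _ _ (Finset.mem_univ i), h1, mul_one]
    simp only [mul_comm]
  simp only [domain, Set.mem_ofPred_eq, he]
  exact ⟨fun h => ⟨fun i => (h.1 i).1, h.2⟩, fun h =>
    ⟨fun i => ⟨h.1 i, (le_influence h0 h1 h.1 i).trans (h.2 i)⟩, h.2⟩⟩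

theorem isCompact_domain : IsCompact (domain r χ) := by
  have hK : IsCompact (Set.Icc (0 : Fin k → ℝ) fun _ => (r : ℝ) / ((r : ℝ) - 1)) := isCompact_Icc
  refine hK.of_isClosed_subset ?_ fun x hx => ⟨fun i => (hx.1 i).1, fun i => (hx.1 i).2⟩
  unfold domain
  simp only [Set.ofPred_and, Set.ofPred_forall]
  refine IsClosed.inter (isClosed_iInter fun i => isClosed_Icc.preimage (continuous_apply i))
    (isClosed_iInter fun i => isClosed_le (by fun_prop) continuous_const)

theorem isCompact_rhoValues [NeZero k] (α : Fin k → ℝ) : IsCompact (rhoValues r χ α) := by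
  have hc : ∀ i, Continuous (rho r χ α i) := fun i => by unfold rho; fun_prop
  refine IsCompact.image ?_ (hc 0)
  refine isCompact_domain.of_isClosed_subset (s := domain r χ) ?_ fun x hx => hx.1
  have : domainRho r χ α = domain r χ ∩ ⋂ i, ⋂ j, {x | rho r χ α i x = rho r χ α j x} := by
    ext; simp [domainRho]
  rw [this]
  exact isCompact_domain.isClosed.inter
    (isClosed_iInter fun i => isClosed_iInter fun j => isClosed_eq (hc i) (hc j))

/-- Below a point at which all `rho` are nonpositive there is a common zero of the `rho`. -/
theorem exists_le_rho_eq_zero (hr : 2 ≤ r) (h0 : ∀ i j, 0 ≤ χ i j) {α x : Fin k → ℝ}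
    (hα : 0 ≤ α) (hx : 0 ≤ x) (hρ : ∀ i, rho r χ α i x ≤ 0) :
    ∃ z, 0 ≤ z ∧ z ≤ x ∧ ∀ i, rho r χ α i z = 0 := by
  have hK : IsCompact (Set.Icc 0 x ∩ ⋂ i, {z | rho r χ α i z ≤ 0}) :=
    isCompact_Icc.inter_right (isClosed_iInter fun i =>
      isClosed_le (by unfold rho; fun_prop) continuous_const)
  obtain ⟨z, ⟨hz, hzρ⟩, hmin⟩ := hK.exists_isMinOn ⟨x, ⟨hx, le_rfl⟩, by simpa using hρ⟩
    (f := fun z => ∑ i, z i) (by fun_prop)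
  simp only [Set.mem_iInter, Set.mem_ofPred_eq] at hzρ
  -- One step of the monotone iteration from the minimiser `z` of the coordinate sum. It stays
  -- admissible and lies below `z`, so minimality forces `w = z`.
  set w : Fin k → ℝ := fun i => α i + gain r (influence χ z i) with hw
  have hwz : w ≤ z := fun i => by
    have := hzρ i
    rw [rho_eq] at this
    simp only [hw]; linarith
  have hw0 : 0 ≤ w := fun i => add_nonneg (hα i) (gain_nonneg hr (influence_nonneg h0 hz.1 i))
  have hwρ : ∀ i, rho r χ α i w ≤ 0 := fun i => by
    have := gain_mono hr (influence_nonneg h0 hw0 i) (influence_mono h0 hwz i)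
    rw [rho_eq]
    have e : w i = α i + gain r (influence χ z i) := rfl
    linarith
  have hsum : ∑ i, z i ≤ ∑ i, w i := hmin ⟨⟨hw0, hwz.trans hz.2⟩, by simpa using hwρ⟩
  have heq : ∀ i ∈ Finset.univ, w i = z i :=
    (Finset.sum_eq_sum_iff_of_le fun i _ => hwz i).1
      (le_antisymm (Finset.sum_le_sum fun i _ => hwz i) hsum)
  refine ⟨z, hz.1, hz.2, fun i => ?_⟩
  have := heq i (Finset.mem_univ i)
  rw [rho_eq]
  simp only [hw] at this; linarith

end Matrix

/-! ### Convex duality: weights, gradients and minimisers. -/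

section Rho

variable {k r : ℕ} {χ : Matrix (Fin k) (Fin k) ℝ}

theorem rho_smul_le {α x : Fin k → ℝ} (hα : 0 ≤ α) {s : ℝ} (hs : s ≤ 1) (i : Fin k) :
    rho r χ (s • α) i x ≤ rho r χ α i x := by
  have := mul_le_mul_of_nonneg_right hs (hα i)
  simp only [rho_eq, Pi.smul_apply, smul_eq_mul] at this ⊢
  linarith

theorem le_one_of_rho_nonpos (hr : 2 ≤ r) (h0 : ∀ i j, 0 ≤ χ i j) (h1 : ∀ i, χ i i = 1)
    {α x : Fin k → ℝ} (hx : 0 ≤ x) {i : Fin k} (h : rho r χ α i x ≤ 0) : α i ≤ 1 := by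
  have := sub_gain_le_one hr (influence_nonneg h0 hx i)
  have := le_influence h0 h1 hx i
  rw [rho_eq] at h
  linarith

/-- The weighted sum of the `rho` is minimal where its gradient vanishes. -/
theorem sum_mul_rho_le (hr : 2 ≤ r) (h0 : ∀ i j, 0 ≤ χ i j) {α θ x z : Fin k → ℝ} (hθ : 0 ≤ θ)
    (hx : 0 ≤ x) (hz : 0 ≤ z)
    (hgrad : ∀ j, ∑ i, θ i * slope r (influence χ x i) * χ i j = θ j) :
    ∑ i, θ i * rho r χ α i x ≤ ∑ i, θ i * rho r χ α i z := by
  have hlin : ∑ i, θ i * slope r (influence χ x i) * influence χ (z - x) i =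
      ∑ j, θ j * (z - x) j := by
    simp only [influence, Finset.mul_sum]
    rw [Finset.sum_comm]
    refine Finset.sum_congr rfl fun j _ => ?_
    rw [← hgrad j, Finset.sum_mul]
    exact Finset.sum_congr rfl fun i _ => by simp only [influence]; ring
  have hterm : ∀ i, θ i * rho r χ α i x + (θ i * slope r (influence χ x i) * influence χ (z - x) i
      - θ i * (z - x) i) ≤ θ i * rho r χ α i z := fun i => by
    have := mul_le_mul_of_nonneg_left
      (gain_tangent hr (influence_nonneg h0 hx i) (influence_nonneg h0 hz i)) (hθ i)
    rw [influence_sub]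
    simp only [rho_eq, Pi.sub_apply]
    linarith
  have := Finset.sum_le_sum fun i (_ : i ∈ Finset.univ) => hterm i
  rw [Finset.sum_add_distrib, Finset.sum_sub_distrib, hlin] at this
  linarith

theorem rho_convex_combination (hr : 2 ≤ r) (h0 : ∀ i j, 0 ≤ χ i j) {α x z : Fin k → ℝ}
    (hx : 0 ≤ x) (hz : 0 ≤ z) {a b : ℝ} (ha : 0 ≤ a) (hb : 0 ≤ b) (hab : a + b = 1) (i : Fin k) :
    rho r χ α i (a • x + b • z) ≤ a * rho r χ α i x + b * rho r χ α i z := by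
  have hw := influence_nonneg h0 (add_nonneg (smul_nonneg ha hx) (smul_nonneg hb hz)) i
  have t1 := mul_le_mul_of_nonneg_left (gain_tangent hr hw (influence_nonneg h0 hx i)) ha
  have t2 := mul_le_mul_of_nonneg_left (gain_tangent hr hw (influence_nonneg h0 hz i)) hb
  have hy := influence_add_smul χ x z a b i
  obtain rfl : b = 1 - a := by linarith
  simp only [rho_eq, Pi.add_apply, Pi.smul_apply, smul_eq_mul]
  set y := influence χ (a • x + (1 - a) • z) i
  have : a * (slope r y * (influence χ x i - y)) + (1 - a) * (slope r y * (influence χ z i - y))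
      = 0 := by rw [hy]; ring
  linarith

/-- If the `rho` are never all negative, then a weighted sum of them is nonnegative. -/
theorem exists_weights (hr : 2 ≤ r) (h0 : ∀ i j, 0 ≤ χ i j) {α x : Fin k → ℝ} (hx : 0 ≤ x)
    (hρ : ∀ i, rho r χ α i x = 0) (hneg : ¬ ∃ z, 0 ≤ z ∧ ∀ i, rho r χ α i z < 0) :
    ∃ θ : Fin k → ℝ, 0 ≤ θ ∧ θ ≠ 0 ∧ ∀ z, 0 ≤ z → 0 ≤ ∑ i, θ i * rho r χ α i z := by
  -- The open negative orthant is separated from the upward closure of the values of `rho`, which is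
  -- convex.
  set N : Set (Fin k → ℝ) := Set.univ.pi fun _ => Set.Iio 0
  set C : Set (Fin k → ℝ) := {v | ∃ z, 0 ≤ z ∧ ∀ i, rho r χ α i z ≤ v i}
  have hC : Convex ℝ C := by
    rintro v ⟨z, hz, hv⟩ w ⟨y, hy, hw⟩ a b ha hb hab
    refine ⟨a • z + b • y, add_nonneg (smul_nonneg ha hz) (smul_nonneg hb hy), fun i => ?_⟩
    exact (rho_convex_combination hr h0 hz hy ha hb hab i).trans (add_le_add
      (mul_le_mul_of_nonneg_left (hv i) ha) (mul_le_mul_of_nonneg_left (hw i) hb))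
  have hdisj : Disjoint N C := Set.disjoint_left.2 fun v hv ⟨z, hz, h⟩ =>
    hneg ⟨z, hz, fun i => (h i).trans_lt (hv i trivial)⟩
  obtain ⟨f, u, hf, hu⟩ := geometric_hahn_banach_open (convex_pi fun _ _ => convex_Iio 0)
    (isOpen_set_pi Set.finite_univ fun _ _ => isOpen_Iio) hC hdisj
  have hone : f (-1) < u := hf _ fun i _ => by simp
  -- The points `-ε` of the orthant tend to the origin.
  have hu0 : 0 ≤ u := by
    have hlim : Tendsto (fun ε : ℝ => f (ε • (-1))) (𝓝[>] 0) (𝓝 (f ((0 : ℝ) • (-1)))) :=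
      ((by fun_prop : Continuous fun ε : ℝ => f (ε • (-1))).tendsto 0).mono_left nhdsWithin_le_nhds
    rw [zero_smul, map_zero] at hlim
    refine le_of_tendsto hlim ?_
    filter_upwards [self_mem_nhdsWithin] with ε hε
    exact (hf _ fun i _ => by simpa using hε).le
  have hsum : ∀ v, f v = ∑ i, f (Pi.single i 1) * v i := fun v => by
    conv_lhs => rw [pi_eq_sum_univ' v, map_sum]
    exact Finset.sum_congr rfl fun i _ => by rw [map_smul, smul_eq_mul, mul_comm]
  -- Since `rho` vanishes at `x`, the set `C` contains the unit vectors, so the weights are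
  -- nonnegative. It also contains the origin, so zero weights would contradict `f (-1) < u ≤ f 0`.
  refine ⟨fun i => f (Pi.single i 1), fun i => hu0.trans (hu _ ⟨x, hx, fun j => ?_⟩), fun h => ?_,
    fun z hz => ?_⟩
  · rw [hρ j]
    by_cases hij : j = i
    · subst hij; simp
    · simp [hij]
  · have hz : f 0 = f (-1) := by
      rw [hsum 0, hsum (-1)]
      simp [fun i => congrFun h i]
    have := hu 0 ⟨x, hx, fun i => (hρ i).le⟩
    linarith
  · rw [← hsum fun i => rho r χ α i z]
    exact hu0.trans (hu _ ⟨z, hz, fun i => le_rfl⟩)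

/-- The gradient of a weighted sum of the `rho` vanishes at an interior minimum. -/
theorem gradient_eq_of_forall_le (hr : 2 ≤ r) {α θ x : Fin k → ℝ} (hx : ∀ i, 0 < x i)
    (hmin : ∀ z, 0 ≤ z → ∑ i, θ i * rho r χ α i x ≤ ∑ i, θ i * rho r χ α i z) (j : Fin k) :
    ∑ i, θ i * slope r (influence χ x i) * χ i j = θ j := by
  set e : Fin k → ℝ := Pi.single j 1
  have hinf : ∀ (t : ℝ) i, influence χ (x + t • e) i = influence χ x i + t * χ i j := by
    intro t i
    simp [influence_mulVec, mulVec_add, mulVec_smul, e]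
  have hder : HasDerivAt (fun t : ℝ => ∑ i, θ i * rho r χ α i (x + t • e))
      (∑ i, θ i * (-e i + slope r (influence χ x i) * χ i j)) 0 := by
    refine HasDerivAt.fun_sum fun i _ => HasDerivAt.const_mul _ ?_
    simp only [rho_eq, hinf]
    have d1 : HasDerivAt (fun t : ℝ => α i - (x + t • e) i) (-e i) 0 := by
      have := ((hasDerivAt_id (0 : ℝ)).mul_const (e i)).const_add (x i) |>.const_sub (α i)
      simpa using this
    have d2 : HasDerivAt (fun t : ℝ => influence χ x i + t * χ i j) (χ i j) 0 := by
      simpa using ((hasDerivAt_id (0 : ℝ)).mul_const (χ i j)).const_add (influence χ x i)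
    have d3 := (d2.pow r).const_mul (coef r)
    refine (d1.add d3).congr_deriv ?_
    rw [slope_eq hr]
    simp only [zero_mul, add_zero]
    ring
  have hloc : IsLocalMin (fun t : ℝ => ∑ i, θ i * rho r χ α i (x + t • e)) 0 := by
    -- Positivity of `x` allows perturbations of both signs, so the derivative vanishes rather than
    -- being merely nonnegative.
    have hev : ∀ᶠ t in 𝓝 (0 : ℝ), ∀ i, 0 < (x + t • e) i := by
      refine eventually_all.2 fun i => ?_
      have hc : ContinuousAt (fun t : ℝ => (x + t • e) i) 0 := by
        simp only [Pi.add_apply, Pi.smul_apply]; fun_prop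
      exact continuousAt_const.eventually_lt hc (by simpa using hx i)
    filter_upwards [hev] with t ht
    simpa using hmin _ fun i => (ht i).le
  have h := hloc.hasDerivAt_eq_zero hder
  simp only [mul_add, Finset.sum_add_distrib, mul_neg, Finset.sum_neg_distrib] at h
  have hj : ∑ i, θ i * e i = θ j := by simp [e, Pi.single_apply]
  rw [hj] at h
  simp only [mul_assoc]
  linarith

/-- For nonzero `α`, every common zero of the `rho` has positive entries. -/
theorem pos_of_rho_eq_zero (hr : 2 ≤ r) (hirr : χ.IsIrreducible) {α x : Fin k → ℝ} (hα : 0 ≤ α)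
    (hα0 : α ≠ 0) (hx : 0 ≤ x) (hρ : ∀ i, rho r χ α i x = 0) (i : Fin k) : 0 < x i := by
  have h0 := hirr.nonneg
  refine (hx i).lt_of_ne fun hi => hα0 ?_
  have hα_le : ∀ i, α i ≤ x i := fun i => by
    have := hρ i
    have := gain_nonneg hr (influence_nonneg h0 hx i)
    rw [rho_eq] at *
    linarith
  -- If `x a = 0`, the equation at `a` forces zero influence on `a`, so `x` vanishes at every `b`
  -- with `χ a b > 0`.
  have hzero : ∀ j, x j = 0 := forall_of_isIrreducible hirr (P := fun j => x j = 0)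
    (fun a b ha hab => by
      have h := hρ a
      have hg : gain r (influence χ x a) = 0 := by
        have := gain_nonneg hr (influence_nonneg h0 hx a)
        have := hα a
        rw [rho_eq] at h
        simp only [Pi.zero_apply] at this
        linarith
      have hy : influence χ x a = 0 :=
        eq_zero_of_pow_eq_zero ((mul_eq_zero.1 hg).resolve_left (coef_pos hr).ne')
      have := (Finset.sum_eq_zero_iff_of_nonneg
        fun j _ => mul_nonneg (hx j) (h0 a j)).1 hy b (Finset.mem_univ b)
      exact (mul_eq_zero.1 this).resolve_right hab.ne') hi.symm
  exact funext fun j => le_antisymm ((hα_le j).trans_eq (hzero j)) (hα j)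

theorem baseVec_apply (θ : Fin k → ℝ) (i : Fin k) :
    baseVec χ θ i = (θ ᵥ* χ⁻¹) i * (θ i)⁻¹ := by
  rw [baseVec, ← vecMul_vecMul, vecMul_diagonal]

theorem sum_mul_eq_vecMul (v θ : Fin k → ℝ) :
    (∀ j, ∑ i, θ i * v i * χ i j = θ j) ↔ (fun i => θ i * v i) ᵥ* χ = θ := by
  rw [funext_iff]; rfl

/-- The gradient condition determines the slopes. -/
theorem gradient_iff_baseVec_eq (hinv : IsUnit χ) {v θ : Fin k → ℝ} (hθ : ∀ i, 0 < θ i) :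
    (∀ j, ∑ i, θ i * v i * χ i j = θ j) ↔ baseVec χ θ = v := by
  have hdet : IsUnit χ.det := (isUnit_iff_isUnit_det χ).1 hinv
  rw [sum_mul_eq_vecMul]
  have : (fun i => θ i * v i) ᵥ* χ = θ ↔ θ ᵥ* χ⁻¹ = fun i => θ i * v i := by
    constructor <;> intro h
    · rw [← congrArg (· ᵥ* χ⁻¹) h]; simp [vecMul_vecMul, mul_nonsing_inv _ hdet]
    · rw [← congrArg (· ᵥ* χ) h]; simp [vecMul_vecMul, nonsing_inv_mul _ hdet]
  rw [this, funext_iff, funext_iff]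
  refine forall_congr' fun i => ?_
  rw [baseVec_apply, ← div_eq_mul_inv, div_eq_iff (hθ i).ne', mul_comm (v i)]

end Rho

/-! ### The three regions and their behaviour along rays. -/

section Regions

variable {k r : ℕ} [NeZero k] {χ : Matrix (Fin k) (Fin k) ℝ}

theorem mem_rhoValues_iff {α : Fin k → ℝ} {v : ℝ} :
    v ∈ rhoValues r χ α ↔ ∃ x ∈ domain r χ, ∀ i, rho r χ α i x = v := by
  constructor
  · rintro ⟨x, hx, rfl⟩
    exact ⟨x, hx.1, fun i => hx.2 i 0⟩
  · rintro ⟨x, hx, h⟩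
    exact ⟨x, ⟨hx, fun i j => (h i).trans (h j).symm⟩, h 0⟩

/-- Raising every seed by a small `ε` keeps all `rho` negative at `x`. A common zero for the raised
seeds is a point where the original `rho` all equal `-ε`. -/
theorem mem_regionSub_iff (hr : 2 ≤ r) (h0 : ∀ i j, 0 ≤ χ i j) (h1 : ∀ i, χ i i = 1)
    {α : Fin k → ℝ} :
    α ∈ regionSub r χ ↔ 0 ≤ α ∧ ∃ x, 0 ≤ x ∧ ∀ i, rho r χ α i x < 0 := by
  constructor
  · rintro ⟨hα, m, hm, hmem, -⟩
    obtain ⟨x, hx, h⟩ := mem_rhoValues_iff.1 hmem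
    exact ⟨hα, x, fun i => (hx.1 i).1, fun i => (h i).trans_lt hm⟩
  · rintro ⟨hα, x, hx, hρ⟩
    have hev : ∀ᶠ ε in 𝓝[>] (0 : ℝ), 0 < ε ∧ ∀ i, ε < -rho r χ α i x :=
      eventually_mem_nhdsWithin.and (eventually_all.2 fun i =>
        Filter.Eventually.mono (Ioo_mem_nhdsGT (neg_pos.2 (hρ i))) fun _ h => h.2)
    obtain ⟨ε, hε, hlt⟩ := hev.exists
    have hshift : ∀ i z, rho r χ (fun j => α j + ε) i z = rho r χ α i z + ε := by
      intro i z; simp only [rho_eq]; ring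
    have hρ' : ∀ i, rho r χ (fun j => α j + ε) i x < 0 := fun i => by
      rw [hshift]; linarith [hlt i]
    obtain ⟨z, hz, hzx, hzρ⟩ := exists_le_rho_eq_zero hr h0
      (α := fun j => α j + ε) (fun i => add_nonneg (hα i) hε.le) hx fun i => (hρ' i).le
    have hy := influence_nonneg h0 hz
    have hd : 0 ≤ x - z := sub_nonneg.2 hzx
    have hzD : z ∈ domain r χ := by
      refine (mem_domain_iff h0 h1).2 ⟨hz, fun i => ?_⟩
      refine le_of_slope_le_one hr ?_ (hy i)
      -- If the slope at `z` exceeded 1, then from `z` to `x` the gain would grow by at least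
      -- `influence χ (x - z) i ≥ x i - z i`, so `rho i` could not decrease from zero to a negative
      -- value.
      by_contra! hs
      have ht := gain_tangent hr (hy i) (influence_nonneg h0 hx i)
      rw [← influence_sub] at ht
      have hle := le_influence h0 h1 hd i
      have hm := mul_le_mul_of_nonneg_right hs.le ((hd i).trans hle)
      have e1 := hρ' i
      have e2 := hzρ i
      rw [rho_eq] at e1 e2
      simp only [Pi.sub_apply] at hle
      linarith
    have hmem : -ε ∈ rhoValues r χ α := mem_rhoValues_iff.2
      ⟨z, hzD, fun i => by have := hzρ i; rw [hshift] at this; linarith⟩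
    obtain ⟨m, hm⟩ := (isCompact_rhoValues α).exists_isLeast ⟨_, hmem⟩
    exact ⟨hα, m, (hm.2 hmem).trans_lt (neg_neg_of_pos hε), hm⟩

theorem mem_regionCrit_iff (hr : 2 ≤ r) (h0 : ∀ i j, 0 ≤ χ i j) (h1 : ∀ i, χ i i = 1)
    {α : Fin k → ℝ} :
    α ∈ regionCrit r χ ↔
      0 ≤ α ∧ α ∉ regionSub r χ ∧ ∃ x ∈ domain r χ, ∀ i, rho r χ α i x = 0 := by
  constructor
  · rintro ⟨hα, h⟩
    refine ⟨hα, ?_, mem_rhoValues_iff.1 h.1⟩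
    rintro ⟨-, m, hm, hl⟩
    exact hm.ne (hl.unique h)
  · rintro ⟨hα, hsub, hx⟩
    refine ⟨hα, mem_rhoValues_iff.2 hx, fun v hv => ?_⟩
    by_contra! hlt
    obtain ⟨x, hx, h⟩ := mem_rhoValues_iff.1 hv
    exact hsub ((mem_regionSub_iff hr h0 h1).2
      ⟨hα, x, fun i => (hx.1 i).1, fun i => (h i).trans_lt hlt⟩)

theorem mem_regionSup_iff {α : Fin k → ℝ} :
    α ∈ regionSup r χ ↔ 0 ≤ α ∧ α ∉ regionSub r χ ∧ α ∉ regionCrit r χ := by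
  constructor
  · rintro ⟨hα, he | ⟨m, hm, hl⟩⟩
    · exact ⟨hα, fun ⟨_, m, _, h⟩ => by simpa [he] using h.1, fun h => by simpa [he] using h.2.1⟩
    · exact ⟨hα, fun ⟨_, m', hm', h⟩ => (hm'.trans hm).ne (h.unique hl),
        fun h => hm.ne (h.2.unique hl)⟩
  · rintro ⟨hα, hs, hc⟩
    refine ⟨hα, (Set.eq_empty_or_nonempty _).imp_right fun hne => ?_⟩
    obtain ⟨m, hm⟩ := (isCompact_rhoValues α).exists_isLeast hne
    rcases lt_trichotomy m 0 with h | rfl | h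
    · exact absurd ⟨hα, m, h, hm⟩ hs
    · exact absurd ⟨hα, hm⟩ hc
    · exact ⟨m, h, hm⟩

theorem zero_mem_regionSub (hr : 2 ≤ r) (h0 : ∀ i j, 0 ≤ χ i j) (h1 : ∀ i, χ i i = 1) :
    (0 : Fin k → ℝ) ∈ regionSub r χ := by
  -- `R` bounds every row sum, so the constant vector `R⁻²` has influence at most `R⁻¹`. As `r ≥ 2`
  -- and `coef r < 1`, its gain is below `R⁻²`.
  set R : ℝ := 1 + ∑ i, ∑ j, χ i j with hR
  have hrow : ∀ i, 0 ≤ ∑ j, χ i j := fun i => Finset.sum_nonneg fun j _ => h0 i j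
  have hR1 : 1 ≤ R := by linarith [Finset.sum_nonneg fun i (_ : i ∈ Finset.univ) => hrow i]
  have hrowR : ∀ i, ∑ j, χ i j ≤ R := fun i => by
    linarith [Finset.single_le_sum (f := fun i => ∑ j, χ i j) (fun i _ => hrow i)
      (Finset.mem_univ i)]
  have hRpos : 0 < R := by linarith
  refine (mem_regionSub_iff hr h0 h1).2 ⟨le_rfl, fun _ => (R ^ 2)⁻¹, fun _ => by
    simp only [Pi.zero_apply]; positivity, fun i => ?_⟩
  have hy : influence χ (fun _ => (R ^ 2)⁻¹) i ≤ R⁻¹ := by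
    rw [influence, ← Finset.mul_sum]
    calc (R ^ 2)⁻¹ * ∑ j, χ i j ≤ (R ^ 2)⁻¹ * R := by gcongr; exact hrowR i
      _ = R⁻¹ := by field_simp
  have hy0 : 0 ≤ influence χ (fun _ => (R ^ 2)⁻¹) i :=
    influence_nonneg h0 (fun _ => by simp only [Pi.zero_apply]; positivity) i
  have hpow : influence χ (fun _ => (R ^ 2)⁻¹) i ^ r ≤ (R ^ 2)⁻¹ :=
    calc _ ≤ R⁻¹ ^ r := pow_le_pow_left₀ hy0 hy r
      _ ≤ R⁻¹ ^ 2 := pow_le_pow_of_le_one (by positivity) (inv_le_one_of_one_le₀ hR1) hr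
      _ = (R ^ 2)⁻¹ := inv_pow _ _
  have hpos : 0 < (R ^ 2)⁻¹ := by positivity
  rw [rho_eq, gain, Pi.zero_apply]
  have := mul_le_mul_of_nonneg_left hpow (coef_pos hr).le
  have := mul_lt_mul_of_pos_right (coef_lt_one hr) hpos
  linarith

theorem smul_mem_regionSub (hr : 2 ≤ r) (h0 : ∀ i j, 0 ≤ χ i j) (h1 : ∀ i, χ i i = 1)
    {α : Fin k → ℝ} (hα : α ∈ regionSub r χ) {s : ℝ} (hs : s ∈ Set.Icc (0 : ℝ) 1) :
    s • α ∈ regionSub r χ := by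
  obtain ⟨hα0, x, hx, h⟩ := (mem_regionSub_iff hr h0 h1).1 hα
  exact (mem_regionSub_iff hr h0 h1).2
    ⟨smul_nonneg hs.1 hα0, x, hx, fun i => (rho_smul_le hα0 hs.2 i).trans_lt (h i)⟩

/-- Every ray from the origin leaves the sub-critical region through the critical region. -/
theorem mem_regionSub_or_exists_smul_mem_regionCrit (hr : 2 ≤ r) (h0 : ∀ i j, 0 ≤ χ i j)
    (h1 : ∀ i, χ i i = 1) {α : Fin k → ℝ} (hα : 0 ≤ α) :
    α ∈ regionSub r χ ∨ ∃ s ∈ Set.Icc (0 : ℝ) 1, s • α ∈ regionCrit r χ := by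
  by_contra! hcon
  obtain ⟨hnot, hcrit⟩ := hcon
  have hcont : ∀ i, Continuous fun z : ℝ × (Fin k → ℝ) => rho r χ (z.1 • α) i z.2 := fun i =>
    (continuous_rho r χ i).comp (by fun_prop : Continuous fun z : ℝ × (Fin k → ℝ) => (z.1 • α, z.2))
  -- Nonstrict inequalities make `T` compact. Without critical points on the segment, its projection
  -- is exactly the set of sub-critical `s`.
  set T : Set (ℝ × (Fin k → ℝ)) :=
    (Set.Icc 0 1 ×ˢ domain r χ) ∩ ⋂ i, {z | rho r χ (z.1 • α) i z.2 ≤ 0} with hT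
  have hTc : IsCompact T := (isCompact_Icc.prod isCompact_domain).inter_right
    (isClosed_iInter fun i => isClosed_le (hcont i) continuous_const)
  have hT_of_sub : ∀ s ∈ Set.Icc (0 : ℝ) 1, s • α ∈ regionSub r χ → ∃ x, (s, x) ∈ T := by
    rintro s hs ⟨-, m, hm, hmem, -⟩
    obtain ⟨x, hx, h⟩ := mem_rhoValues_iff.1 hmem
    exact ⟨x, ⟨hs, hx⟩, by simpa using fun i => (h i).trans_le hm.le⟩
  have hsub_of_T : ∀ s x, (s, x) ∈ T → s • α ∈ regionSub r χ := by
    rintro s x ⟨⟨hs, hx⟩, hρ⟩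
    simp only [Set.mem_iInter, Set.mem_ofPred_eq] at hρ
    by_contra hns
    obtain ⟨hx0, hxb⟩ := (mem_domain_iff h0 h1).1 hx
    obtain ⟨z, hz, hzx, hzρ⟩ := exists_le_rho_eq_zero hr h0 (smul_nonneg hs.1 hα) hx0 hρ
    exact hcrit s hs ((mem_regionCrit_iff hr h0 h1).2 ⟨smul_nonneg hs.1 hα, hns, z,
      (mem_domain_iff h0 h1).2 ⟨hz, fun i => (influence_mono h0 hzx i).trans (hxb i)⟩, hzρ⟩)
  obtain ⟨x₀, hx₀⟩ := hT_of_sub 0 ⟨le_rfl, zero_le_one⟩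
    (by rw [zero_smul]; exact zero_mem_regionSub hr h0 h1)
  obtain ⟨⟨s, x⟩, hsx, hmax⟩ := hTc.exists_isMaxOn ⟨_, hx₀⟩ (f := Prod.fst) (by fun_prop)
  have hsI : s ∈ Set.Icc (0 : ℝ) 1 := hsx.1.1
  have hs1 : s < 1 := hsI.2.lt_of_ne fun h => hnot (by simpa [h] using hsub_of_T s x hsx)
  obtain ⟨-, w, hw, hwρ⟩ := (mem_regionSub_iff hr h0 h1).1 (hsub_of_T s x hsx)
  -- The strict inequalities at `w` survive a slight increase of `s`, against its maximality.
  have hev : ∀ᶠ u in 𝓝[>] s, u ∈ Set.Ioo s 1 ∧ ∀ i, rho r χ (u • α) i w < 0 :=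
    Filter.Eventually.and (Ioo_mem_nhdsGT hs1) (eventually_all.2 fun i =>
      nhdsWithin_le_nhds (((hcont i).comp (Continuous.prodMk_left w)).continuousAt.eventually_lt
        continuousAt_const (hwρ i)))
  obtain ⟨u, hu, huρ⟩ := hev.exists
  have huI : u ∈ Set.Icc (0 : ℝ) 1 := ⟨hsI.1.trans hu.1.le, hu.2.le⟩
  obtain ⟨z, hz⟩ := hT_of_sub u huI
    ((mem_regionSub_iff hr h0 h1).2 ⟨smul_nonneg huI.1 hα, w, hw, huρ⟩)
  exact absurd (hmax hz) (not_le.2 hu.1)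

theorem exists_pos_gradient_of_mem_regionCrit (hr : 2 ≤ r) (h1 : ∀ i, χ i i = 1)
    (hirr : χ.IsIrreducible) {α : Fin k → ℝ} (hα : α ∈ regionCrit r χ) :
    ∃ x ∈ domain r χ, (∀ i, rho r χ α i x = 0) ∧ ∃ θ : Fin k → ℝ, θ 0 = 1 ∧ (∀ i, 0 < θ i) ∧
      ∀ j, ∑ i, θ i * slope r (influence χ x i) * χ i j = θ j := by
  have h0 := hirr.nonneg
  obtain ⟨hα0, hns, x, hxD, hρ⟩ := (mem_regionCrit_iff hr h0 h1).1 hα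
  have hx0 := ((mem_domain_iff h0 h1).1 hxD).1
  have hαne : α ≠ 0 := fun h => hns (h ▸ zero_mem_regionSub hr h0 h1)
  have hx := pos_of_rho_eq_zero hr hirr hα0 hαne hx0 hρ
  obtain ⟨θ, hθ, hθne, hmin⟩ := exists_weights hr h0 hx0 hρ
    fun h => hns ((mem_regionSub_iff hr h0 h1).2 ⟨hα0, h⟩)
  have hgrad := gradient_eq_of_forall_le (χ := χ) (α := α) (θ := θ) hr hx
    fun z hz => by simpa [hρ] using hmin z hz
  have hy : ∀ i, 0 < influence χ x i := fun i => (hx i).trans_le (le_influence h0 h1 hx0 i)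
  have hnn : ∀ i j, 0 ≤ θ i * slope r (influence χ x i) * χ i j := fun i j =>
    mul_nonneg (mul_nonneg (hθ i) (slope_pos hr (hy i)).le) (h0 i j)
  obtain ⟨i₀, hi₀⟩ := Function.ne_iff.1 hθne
  -- The gradient identity bounds `θ j` below by `θ i * slope * χ i j`, so positivity spreads along
  -- positive entries.
  have hpos : ∀ i, 0 < θ i := forall_of_isIrreducible hirr (P := fun i => 0 < θ i)
    (fun i j hi hij => by
      rw [← hgrad j]
      exact (mul_pos (mul_pos hi (slope_pos hr (hy i))) hij).trans_le
        (Finset.single_le_sum (f := fun i => θ i * slope r (influence χ x i) * χ i j)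
          (fun i _ => hnn i j) (Finset.mem_univ i))) ((hθ i₀).lt_of_ne' hi₀)
  refine ⟨x, hxD, hρ, fun i => θ i / θ 0, div_self (hpos 0).ne',
    fun i => div_pos (hpos i) (hpos 0), fun j => ?_⟩
  beta_reduce
  rw [← hgrad j, Finset.sum_div]
  exact Finset.sum_congr rfl fun i _ => by ring

/-- The critical region in terms of the left eigenvectors `θ`. -/
theorem regionCrit_eq (hr : 2 ≤ r) (h1 : ∀ i, χ i i = 1) (hirr : χ.IsIrreducible)
    (hinv : IsUnit χ) :
    regionCrit r χ = {α | (∀ i, α i ∈ Set.Icc (0 : ℝ) 1) ∧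
      ∃ θ : Fin k → ℝ, θ 0 = 1 ∧ (∀ i, 0 < θ i) ∧ (∀ i, 0 ≤ baseVec χ θ i) ∧
        ∀ i, α i = (xVec r χ θ ᵥ* (χ⁻¹)ᵀ) i -
          (r : ℝ)⁻¹ * (1 - (r : ℝ)⁻¹) ^ (r - 1) * xVec r χ θ i ^ r} := by
  have h0 := hirr.nonneg
  have hdet : IsUnit χ.det := (isUnit_iff_isUnit_det χ).1 hinv
  ext α
  constructor
  · intro hα
    obtain ⟨x, hxD, hρ, θ, hθ1, hθ, hgrad⟩ := exists_pos_gradient_of_mem_regionCrit hr h1 hirr hα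
    have hx0 := ((mem_domain_iff h0 h1).1 hxD).1
    have hy := influence_nonneg h0 hx0
    have hbase := (gradient_iff_baseVec_eq hinv hθ).1 hgrad
    have hxVec : xVec r χ θ = influence χ x := funext fun i => by
      rw [xVec, hbase]; exact slope_rpow hr (hy i)
    refine ⟨fun i => ⟨hα.1 i, le_one_of_rho_nonpos hr h0 h1 hx0 (hρ i).le⟩, θ, hθ1, hθ,
      fun i => ?_, fun i => ?_⟩
    · rw [hbase]; exact slope_nonneg hr (hy i)
    · have hback : influence χ x ᵥ* (χ⁻¹)ᵀ = x := by
        rw [vecMul_transpose, influence_mulVec, mulVec_mulVec, nonsing_inv_mul _ hdet, one_mulVec]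
      rw [hxVec, hback]
      have := hρ i
      rw [rho_eq, gain, coef] at this
      linarith
  · rintro ⟨hα, θ, -, hθ, hbase, hαeq⟩
    set y := xVec r χ θ with hy
    set x := y ᵥ* (χ⁻¹)ᵀ with hx
    have hxy : influence χ x = y := by
      rw [influence_mulVec, hx, vecMul_transpose, mulVec_mulVec, mul_nonsing_inv _ hdet,
        one_mulVec]
    have hy0 : ∀ i, 0 ≤ y i := fun i =>
      mul_nonneg (div_sub_one_pos hr).le (Real.rpow_nonneg (hbase i) _)
    have hα0 : 0 ≤ α := fun i => (hα i).1
    have hρ : ∀ i, rho r χ α i x = 0 := fun i => by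
      rw [rho_eq, hxy, gain, coef, hαeq i]; ring
    have hx0 : 0 ≤ x := fun i => by
      have h := hρ i
      have := gain_nonneg hr (hy0 i)
      have := hα0 i
      rw [rho_eq, hxy] at h
      simp only [Pi.zero_apply] at this ⊢
      linarith
    have hslope : baseVec χ θ = fun i => slope r (influence χ x i) := funext fun i => by
      rw [hxy]; exact (slope_of_rpow hr (hbase i)).symm
    have hgrad := (gradient_iff_baseVec_eq hinv hθ).2 hslope
    -- The diagonal term of the gradient identity is at most `θ i`. This puts `x` in the domain.
    have hle : ∀ i, slope r (influence χ x i) ≤ 1 := fun i => by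
      have hs := Finset.single_le_sum (f := fun j => θ j * slope r (influence χ x j) * χ j i)
        (fun j _ => mul_nonneg (mul_nonneg (hθ j).le (slope_nonneg hr (hxy ▸ hy0 j))) (h0 j i))
        (Finset.mem_univ i)
      simp only [hgrad i, h1, mul_one] at hs
      exact (mul_le_iff_le_one_right (hθ i)).1 hs
    refine (mem_regionCrit_iff hr h0 h1).2 ⟨hα0, fun hsub => ?_, x, (mem_domain_iff h0 h1).2
      ⟨hx0, fun i => le_of_slope_le_one hr (hle i) (hxy ▸ hy0 i)⟩, hρ⟩
    obtain ⟨-, z, hz, hzρ⟩ := (mem_regionSub_iff hr h0 h1).1 hsub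
    have hmin := sum_mul_rho_le (α := α) hr h0 (fun i => (hθ i).le) hx0 hz hgrad
    simp only [hρ, mul_zero, Finset.sum_const_zero] at hmin
    exact hmin.not_gt (Finset.sum_neg (fun i _ => mul_neg_of_pos_of_neg (hθ i) (hzρ i))
      Finset.univ_nonempty)

theorem regionSub_eq (hr : 2 ≤ r) (h0 : ∀ i j, 0 ≤ χ i j) (h1 : ∀ i, χ i i = 1) :
    regionSub r χ = {α | (∀ i, α i ∈ Set.Icc (0 : ℝ) 1) ∧
      (fun s : ℝ => s • α) '' Set.Icc (0 : ℝ) 1 ∩ regionCrit r χ = ∅} := by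
  ext α
  constructor
  · intro hα
    obtain ⟨hα0, x, hx, h⟩ := (mem_regionSub_iff hr h0 h1).1 hα
    refine ⟨fun i => ⟨hα0 i, le_one_of_rho_nonpos hr h0 h1 hx (h i).le⟩,
      Set.eq_empty_iff_forall_notMem.2 ?_⟩
    rintro _ ⟨⟨s, hs, rfl⟩, hc⟩
    exact ((mem_regionCrit_iff hr h0 h1).1 hc).2.1 (smul_mem_regionSub hr h0 h1 hα hs)
  · rintro ⟨hα, he⟩
    refine (mem_regionSub_or_exists_smul_mem_regionCrit hr h0 h1
      fun i => (hα i).1).resolve_right ?_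
    rintro ⟨s, hs, hc⟩
    exact Set.eq_empty_iff_forall_notMem.1 he _ ⟨⟨s, hs, rfl⟩, hc⟩

theorem regionSup_eq (hr : 2 ≤ r) (h1 : ∀ i, χ i i = 1) (hirr : χ.IsIrreducible) :
    regionSup r χ = {α | (∀ i, 0 ≤ α i) ∧
      ((fun s : ℝ => s • α) '' Set.Ico (0 : ℝ) 1 ∩ regionCrit r χ).Nonempty} := by
  have h0 := hirr.nonneg
  ext α
  rw [mem_regionSup_iff]
  constructor
  · rintro ⟨hα, hns, hnc⟩
    obtain ⟨s, hs, hc⟩ :=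
      (mem_regionSub_or_exists_smul_mem_regionCrit hr h0 h1 hα).resolve_left hns
    refine ⟨hα, s • α, ⟨s, ⟨hs.1, hs.2.lt_of_ne fun h => hnc ?_⟩, rfl⟩, hc⟩
    rwa [h, one_smul] at hc
  · rintro ⟨hα, _, ⟨s, hs, rfl⟩, hc⟩
    beta_reduce at hc
    have hns := ((mem_regionCrit_iff hr h0 h1).1 hc).2.1
    refine ⟨hα, fun h => hns (smul_mem_regionSub hr h0 h1 h ⟨hs.1, hs.2.le⟩), fun h => ?_⟩
    obtain ⟨-, -, z, hzD, hz⟩ := (mem_regionCrit_iff hr h0 h1).1 h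
    have hz0 := ((mem_domain_iff h0 h1).1 hzD).1
    obtain ⟨x, hxD, hρ, θ, -, hθ, hgrad⟩ := exists_pos_gradient_of_mem_regionCrit hr h1 hirr hc
    have hmin := sum_mul_rho_le (α := s • α) hr h0 (fun i => (hθ i).le)
      ((mem_domain_iff h0 h1).1 hxD).1 hz0 hgrad
    -- If `α` were critical too, its common zero `z` would give a weighted sum `(s - 1) ∑ θ i α i`
    -- no smaller than the minimum 0. Then `α = 0`, which is sub-critical.
    have hzs : ∀ i, rho r χ (s • α) i z = (s - 1) * α i := fun i => by
      have := hz i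
      rw [rho_eq] at this ⊢
      simp only [Pi.smul_apply, smul_eq_mul]
      linarith
    simp only [hρ, hzs, mul_zero, Finset.sum_const_zero] at hmin
    have hterm : ∀ i ∈ Finset.univ, θ i * ((s - 1) * α i) ≤ 0 := fun i _ =>
      mul_nonpos_of_nonneg_of_nonpos (hθ i).le
        (mul_nonpos_of_nonpos_of_nonneg (by linarith [hs.2]) (hα i))
    have hz := (Finset.sum_eq_zero_iff_of_nonpos hterm).1
      (le_antisymm (Finset.sum_nonpos hterm) hmin)
    have hα0 : α = 0 := funext fun i => by
      have := (mul_eq_zero.1 (hz i (Finset.mem_univ i))).resolve_left (hθ i).ne'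
      exact (mul_eq_zero.1 this).resolve_left (by linarith [hs.2])
    exact hns (by rw [hα0, smul_zero]; exact zero_mem_regionSub hr h0 h1)

end Regions

end BlockPercolation

theorem mainTheorem4 {k : ℕ} [NeZero k] (hk : 2 ≤ k) {r : ℕ} (hr : 2 ≤ r)
    (S : SBMSequence k) (ν γ μ : Fin k → Fin k → ℝ) (hS : S.Assumptions r ν γ μ)
    (χ : Matrix (Fin k) (Fin k) ℝ) (hχ : χ = BlockPercolation.chi r ν γ μ)
    (hirr : χ.IsIrreducible) (hinv : IsUnit χ) :
    BlockPercolation.regionCrit r χ =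
        {α | (∀ i, α i ∈ Set.Icc (0 : ℝ) 1) ∧
          ∃ θ : Fin k → ℝ, θ 0 = 1 ∧ (∀ i, 0 < θ i) ∧
            (∀ i, 0 ≤ BlockPercolation.baseVec χ θ i) ∧
            ∀ i, α i = (BlockPercolation.xVec r χ θ ᵥ* (χ⁻¹)ᵀ) i -
              (r : ℝ)⁻¹ * (1 - (r : ℝ)⁻¹) ^ (r - 1) * BlockPercolation.xVec r χ θ i ^ r} ∧
      BlockPercolation.regionSub r χ =
        {α | (∀ i, α i ∈ Set.Icc (0 : ℝ) 1) ∧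
          (fun s : ℝ => s • α) '' Set.Icc (0 : ℝ) 1 ∩ BlockPercolation.regionCrit r χ = ∅} ∧
      BlockPercolation.regionSup r χ =
        {α | (∀ i, 0 ≤ α i) ∧
          ((fun s : ℝ => s • α) '' Set.Ico (0 : ℝ) 1 ∩
            BlockPercolation.regionCrit r χ).Nonempty} := by
  subst hχ
  have h1 := BlockPercolation.chi_diag hS
  exact ⟨BlockPercolation.regionCrit_eq hr h1 hirr hinv,
    BlockPercolation.regionSub_eq hr hirr.nonneg h1,
    BlockPercolation.regionSup_eq hr h1 hirr⟩
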